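/- Let $H$ be a separable complex Hilbert space, $J$ a complex conjugation on $H$ (an antiunitary involution), and $Q$ an orthogonal projection on $H$ commuting with $J$; put $Q^\perp=1-Q$. For a Hilbert space $K$ with conjugation $I$ let $\mathrm{CAR}(K,I)$ be the (universal, unital) C*-algebra generated by operators $B(f)$, $f\in K$, with $f\mapsto B(f)$ complex linear, $B(f)^*=B(If)$ and $B(f)B(h)+B(h)B(f)=\langle If,h\rangle 1$. Let $H_Q=H\oplus Q^\perp H$ with the conjugation $J_Q=R_Q(J\oplus Q^\perp J)$, where $R_Q(f\oplus h)=(Qf+h)\oplus Q^\perp f$, and put $G(f)=B(f\oplus 0)\in \mathrm{CAR}(H_Q,J_Q)$ for $f\in H$. The GAR algebra $\mathcal G$ is the norm-closed unital subalgebra of $\mathrm{CAR}(H_Q,J_Q)$ generated by all $G(f)$, $f\in H$. Its adjoint $^\star$ is the continuous conjugate-linear, product-reversing involution with $G(f)^\star=G(Jf)$. Its fermionic part $\mathcal F$ is the norm-closed unital subalgebra generated by the $G(Qf)$; it is the CAR subalgebra $\mathrm{CAR}(QH,QJ)$, it is stable under the C*-adjoint $^*$, and it is regarded as a C*-algebra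 with this adjoint. Its Grassmann part is the norm-closed unital subalgebra generated by the $G(Q^\perp f)$. Let $\mathcal I$ be the norm-closed two-sided ideal of $\mathcal G$ generated by the elements $Z$ of the Grassmann part that are selfadjoint ($Z^\star=Z$) and nilpotent. A positive functional on a *-algebra is a linear functional $\omega$ (not assumed continuous) with $\omega(A^\star A)\ge 0$ for all $A$. (1) There is a surjective *-homomorphism $\epsilon_Q:\mathcal G\to\mathcal F=\mathrm{CAR}(QH,QJ)$ such that $\epsilon_Q(Z)=0$ for all $Z\in\mathcal I$ and $\epsilon_Q(A)=A$ for all $A\in\mathcal F$. (2) For every positive functional $\omega$ on $\mathcal G$ there is a unique positive functional $\omega'$ on $\mathcal F$ such that $\omega=\omega'\circ\epsilon_Q$. -/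

import Mathlib

open scoped ENNReal InnerProductSpace ComplexConjugate

noncomputable section

namespace GrassmannCAR

universe u

section CAR

/-- A complex conjugation on a complex inner product space: an antiunitary involution. -/
structure Conjugation (H : Type u) [NormedAddCommGroup H] [InnerProductSpace ℂ H] where
  toFun : H → H
  map_add : ∀ f g, toFun (f + g) = toFun f + toFun g
  map_smul : ∀ (c : ℂ) (f : H), toFun (c • f) = conj c • toFun f
  involutive : ∀ f, toFun (toFun f) = f
  inner_map : ∀ f g, ⟪toFun f, toFun g⟫_ℂ = ⟪g, f⟫_ℂ

instance {H : Type u} [NormedAddCommGroup H] [InnerProductSpace ℂ H] :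
    CoeFun (Conjugation H) (fun _ => H → H) := ⟨Conjugation.toFun⟩

variable {H : Type u} [NormedAddCommGroup H] [InnerProductSpace ℂ H]

/-- A realization of the selfdual canonical anticommutation relations over `(H, J)` in a nonzero
unital C*-algebra: a complex linear map `b` with `b(f)* = b(Jf)` and
`b(f) b(g) + b(g) b(f) = ⟨Jf, g⟩ 1`. -/
structure CARRep (J : Conjugation H) where
  carrier : Type u
  [cstar : CStarAlgebra carrier]
  [nontriv : Nontrivial carrier]
  b : H →ₗ[ℂ] carrier
  star_b : ∀ f, star (b f) = b (J f)
  anticomm : ∀ f g, b f * b g + b g * b f = ⟪J f, g⟫_ℂ • (1 : carrier)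

attribute [instance] CARRep.cstar CARRep.nontriv

variable {J : Conjugation H}

theorem CARRep.norm_b_le (ρ : CARRep J) (f : H) : ‖ρ.b f‖ ≤ ‖f‖ := by
  let _ := CStarAlgebra.spectralOrder ρ.carrier
  let _ := CStarAlgebra.spectralOrderedRing ρ.carrier
  have h1 : star (ρ.b f) * ρ.b f ≤ ((‖f‖ ^ 2 : ℝ) : ℂ) • (1 : ρ.carrier) := by
    have h2 := ρ.anticomm (J f) f
    rw [J.involutive, inner_self_eq_norm_sq_to_K] at h2
    rw [Complex.ofReal_pow]
    have h3 : 0 ≤ ρ.b f * star (ρ.b f) := mul_star_self_nonneg _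
    calc star (ρ.b f) * ρ.b f ≤ star (ρ.b f) * ρ.b f + ρ.b f * star (ρ.b f) :=
          le_add_of_nonneg_right h3
      _ = _ := by rw [ρ.star_b]; exact h2
  have h4 := CStarAlgebra.norm_le_norm_of_nonneg_of_le (star_mul_self_nonneg _) h1
  rw [CStarRing.norm_star_mul_self, norm_smul, norm_one, mul_one, Complex.norm_real,
    Real.norm_of_nonneg (by positivity), ← sq] at h4
  exact (sq_le_sq₀ (norm_nonneg _) (norm_nonneg _)).1 h4

/-- The C*-algebra of uniformly bounded families indexed by all realizations of the relations,
with the supremum norm. -/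
abbrev CARProd (J : Conjugation H) : Type (u + 1) := lp (fun ρ : CARRep J => ρ.carrier) ∞

/-- The universal selfdual field operator: the family `(ρ(f))_ρ`. -/
def fieldProd (J : Conjugation H) : H →ₗ[ℂ] CARProd J where
  toFun f := ⟨fun ρ => ρ.b f, memℓp_infty ⟨‖f‖, by
    rintro _ ⟨ρ, rfl⟩
    exact ρ.norm_b_le f⟩⟩
  map_add' f g := by ext ρ; exact ρ.b.map_add f g
  map_smul' c f := by ext ρ; exact ρ.b.map_smul c f

/-- The selfdual CAR algebra over `(H, J)`: the universal C*-algebra generated by the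
field operators, i.e. the C*-algebra generated by the universal fields inside the product over
all realizations. Thus the norm of a noncommutative polynomial in the fields is the supremum of
its norms in all realizations. -/
def CAR (J : Conjugation H) : StarSubalgebra ℂ (CARProd J) :=
  (StarAlgebra.adjoin ℂ (Set.range (fieldProd J))).topologicalClosure

instance instRingCAR (J : Conjugation H) : Ring (CAR J) := inferInstance

instance instAlgebraCAR (J : Conjugation H) : Algebra ℂ (CAR J) := inferInstance

/-- The field operators `B(f)`. -/
def field (J : Conjugation H) : H →ₗ[ℂ] CAR J where
  toFun f := ⟨fieldProd J f, subset_closure (StarAlgebra.subset_adjoin ℂ _ ⟨f, rfl⟩)⟩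
  map_add' f g := Subtype.ext ((fieldProd J).map_add f g)
  map_smul' c f := Subtype.ext ((fieldProd J).map_smul c f)

theorem star_fieldProd (f : H) : star (fieldProd J f) = fieldProd J (J f) := by
  ext ρ
  exact ρ.star_b f

theorem star_field (f : H) : star (field J f) = field J (J f) := Subtype.ext (star_fieldProd f)

theorem field_anticomm (f g : H) :
    field J f * field J g + field J g * field J f = ⟪J f, g⟫_ℂ • (1 : CAR J) := by
  apply Subtype.ext
  ext ρ
  exact ρ.anticomm f g

/-! Second quantization of a linear isometry that commutes with the conjugation. -/

/-- Pulling a realization back along an isometry `W` that commutes with `J`. -/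
def CARRep.pullback (ρ : CARRep J) (W : H →ₗᵢ[ℂ] H) (hW : ∀ f, W (J f) = J (W f)) :
    CARRep J where
  carrier := ρ.carrier
  b := ρ.b ∘ₗ W.toLinearMap
  star_b f := by simp [ρ.star_b, hW]
  anticomm f g := by
    have h := ρ.anticomm (W f) (W g)
    rwa [← hW, W.inner_map_map] at h

/-- The *-homomorphism of the product determined by `B(f) ↦ B(Wf)`. -/
def bogoliubovProd (W : H →ₗᵢ[ℂ] H) (hW : ∀ f, W (J f) = J (W f)) :
    CARProd J →⋆ₐ[ℂ] CARProd J where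
  toFun x := ⟨fun ρ => x (ρ.pullback W hW), memℓp_infty ⟨‖x‖, by
    rintro _ ⟨ρ, rfl⟩
    exact lp.norm_apply_le_norm (by simp) x (ρ.pullback W hW)⟩⟩
  map_one' := rfl
  map_mul' _ _ := rfl
  map_zero' := rfl
  map_add' _ _ := rfl
  commutes' _ := rfl
  map_star' _ := rfl

theorem bogoliubovProd_field (W : H →ₗᵢ[ℂ] H) (hW : ∀ f, W (J f) = J (W f)) (f : H) :
    bogoliubovProd W hW (fieldProd J f) = fieldProd J (W f) := rfl

theorem norm_bogoliubovProd_le (W : H →ₗᵢ[ℂ] H) (hW : ∀ f, W (J f) = J (W f))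
    (x : CARProd J) : ‖bogoliubovProd W hW x‖ ≤ ‖x‖ :=
  lp.norm_le_of_forall_le (norm_nonneg x) fun ρ =>
    lp.norm_apply_le_norm (by simp) x (ρ.pullback W hW)

theorem continuous_bogoliubovProd (W : H →ₗᵢ[ℂ] H) (hW : ∀ f, W (J f) = J (W f)) :
    Continuous (bogoliubovProd (J := J) W hW) :=
  AddMonoidHomClass.continuous_of_bound (bogoliubovProd (J := J) W hW) 1
    fun x => by simpa using norm_bogoliubovProd_le W hW x

theorem bogoliubovProd_mem (W : H →ₗᵢ[ℂ] H) (hW : ∀ f, W (J f) = J (W f)) {x : CARProd J}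
    (hx : x ∈ CAR J) : bogoliubovProd W hW x ∈ CAR J := by
  refine map_mem_closure (continuous_bogoliubovProd W hW) hx fun y hy => ?_
  have : StarAlgebra.adjoin ℂ (Set.range (fieldProd J)) ≤
      (StarAlgebra.adjoin ℂ (Set.range (fieldProd J))).comap (bogoliubovProd W hW) := by
    apply StarAlgebra.adjoin_le
    rintro _ ⟨f, rfl⟩
    exact StarAlgebra.subset_adjoin ℂ _ ⟨W f, rfl⟩
  exact this hy

end CAR

section GAR

/-- A complex conjugation `J` and an orthogonal projection `Q` that commutes with `J`. -/
structure GARData (H : Type u) [NormedAddCommGroup H] [InnerProductSpace ℂ H]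
    [CompleteSpace H] where
  J : Conjugation H
  Q : H →L[ℂ] H
  isStarProjection : IsStarProjection Q
  comm : ∀ f, Q (J f) = J (Q f)

variable {H : Type u} [NormedAddCommGroup H] [InnerProductSpace ℂ H] [CompleteSpace H]

namespace GARData

variable (T : GARData H)

/-- The complementary projection `Q^⊥ = 1 - Q`. -/
def Qperp : H →L[ℂ] H := 1 - T.Q

/-- The subspace `Q^⊥ H`. -/
def perpSpace : Submodule ℂ H := LinearMap.range (T.Qperp : H →ₗ[ℂ] H)

theorem Q_Q (f : H) : T.Q (T.Q f) = T.Q f :=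
  congrArg (fun A : H →L[ℂ] H => A f) T.isStarProjection.isIdempotentElem.eq

theorem Qperp_apply (f : H) : T.Qperp f = f - T.Q f := rfl

theorem inner_Q_left (f g : H) : ⟪T.Q f, g⟫_ℂ = ⟪f, T.Q g⟫_ℂ := by
  have h : ContinuousLinearMap.adjoint T.Q = T.Q := T.isStarProjection.isSelfAdjoint
  rw [← ContinuousLinearMap.adjoint_inner_right, h]

theorem Q_of_mem {h : H} (hh : h ∈ T.perpSpace) : T.Q h = 0 := by
  obtain ⟨g, rfl⟩ := hh
  change T.Q (T.Qperp g) = 0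
  rw [Qperp_apply, map_sub, Q_Q, sub_self]

theorem Qperp_of_mem {h : H} (hh : h ∈ T.perpSpace) : T.Qperp h = h := by
  rw [Qperp_apply, T.Q_of_mem hh, sub_zero]

theorem J_sub (f g : H) : T.J (f - g) = T.J f - T.J g := by
  have h := T.J.map_smul (-1) g
  rw [sub_eq_add_neg, T.J.map_add, ← neg_one_smul ℂ g, h]
  simp [sub_eq_add_neg]

theorem Qperp_J (f : H) : T.Qperp (T.J f) = T.J (T.Qperp f) := by
  rw [Qperp_apply, Qperp_apply, J_sub, T.comm]

theorem J_mem {h : H} (hh : h ∈ T.perpSpace) : T.J h ∈ T.perpSpace := by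
  obtain ⟨g, rfl⟩ := hh
  exact ⟨T.J g, T.Qperp_J g⟩

/-- The Hilbert space `H_Q = H ⊕ Q^⊥ H`. -/
abbrev HQ : Type u := WithLp 2 (H × T.perpSpace)

theorem HQ_ext {x y : T.HQ} (h1 : x.fst = y.fst) (h2 : (x.snd : H) = y.snd) : x = y :=
  WithLp.ofLp_injective 2 (Prod.ext h1 (Subtype.ext h2))

/-- The reflection `R_Q (f ⊕ h) = (Q f + h) ⊕ Q^⊥ f`. -/
def RQ : T.HQ →ₗᵢ[ℂ] T.HQ :=
  LinearMap.isometryOfInner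
    { toFun := fun x => WithLp.toLp 2 (T.Q x.fst + (x.snd : H), ⟨T.Qperp x.fst, x.fst, rfl⟩)
      map_add' := fun x y => by
        refine T.HQ_ext ?_ ?_
        · change T.Q (x.fst + y.fst) + ((x.snd : H) + (y.snd : H)) =
            (T.Q x.fst + (x.snd : H)) + (T.Q y.fst + (y.snd : H))
          rw [map_add]
          abel
        · simp
      map_smul' := fun c x => by
        refine T.HQ_ext ?_ ?_
        · simp
        · simp }
    (fun x y => by
      have h1 : ⟪T.Q x.fst, (y.snd : H)⟫_ℂ = 0 := by
        rw [inner_Q_left, T.Q_of_mem y.snd.2, inner_zero_right]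
      have h2 : ⟪(x.snd : H), T.Q y.fst⟫_ℂ = 0 := by
        rw [← inner_Q_left, T.Q_of_mem x.snd.2, inner_zero_left]
      have h3 : ⟪T.Q x.fst, T.Q y.fst⟫_ℂ = ⟪x.fst, T.Q y.fst⟫_ℂ := by
        rw [inner_Q_left, Q_Q]
      have h4 : ⟪T.Q x.fst, y.fst⟫_ℂ = ⟪x.fst, T.Q y.fst⟫_ℂ := T.inner_Q_left _ _
      simp only [LinearMap.coe_mk, AddHom.coe_mk, WithLp.prod_inner_apply, Submodule.coe_inner,
        WithLp.ofLp_fst, WithLp.ofLp_snd, Qperp_apply,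
        inner_add_left, inner_add_right, inner_sub_left, inner_sub_right, h1, h2, h3, h4]
      ring)

/-- The conjugation `J ⊕ Q^⊥ J` of `H ⊕ Q^⊥ H`. -/
def JJ : Conjugation T.HQ where
  toFun x := WithLp.toLp 2 (T.J x.fst, ⟨T.J x.snd, T.J_mem x.snd.2⟩)
  map_add x y := by
    refine T.HQ_ext ?_ ?_
    · simp [T.J.map_add]
    · simp [T.J.map_add]
  map_smul c x := by
    refine T.HQ_ext ?_ ?_
    · simp [T.J.map_smul]
    · simp [T.J.map_smul]
  involutive x := by
    refine T.HQ_ext ?_ ?_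
    · simp [T.J.involutive]
    · simp [T.J.involutive]
  inner_map x y := by
    simp [WithLp.prod_inner_apply, Submodule.coe_inner, T.J.inner_map]

theorem RQ_RQ (x : T.HQ) : T.RQ (T.RQ x) = x := by
  refine T.HQ_ext ?_ ?_
  · change T.Q (T.Q x.fst + (x.snd : H)) + T.Qperp x.fst = x.fst
    rw [map_add, Q_Q, T.Q_of_mem x.snd.2, Qperp_apply]
    abel
  · change T.Qperp (T.Q x.fst + (x.snd : H)) = x.snd
    rw [map_add, T.Qperp_of_mem x.snd.2, Qperp_apply, Q_Q]
    abel

theorem RQ_JJ (x : T.HQ) : T.RQ (T.JJ x) = T.JJ (T.RQ x) := by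
  refine T.HQ_ext ?_ ?_
  · change T.Q (T.J x.fst) + T.J (x.snd : H) = T.J (T.Q x.fst + (x.snd : H))
    rw [T.J.map_add, T.comm]
  · exact T.Qperp_J x.fst

/-- The conjugation `J_Q = R_Q (J ⊕ Q^⊥ J)`. -/
def JQ : Conjugation T.HQ where
  toFun x := T.RQ (T.JJ x)
  map_add x y := by rw [T.JJ.map_add, map_add]
  map_smul c x := by rw [T.JJ.map_smul, map_smul]
  involutive x := by rw [T.RQ_JJ, T.RQ_RQ, T.JJ.involutive]
  inner_map x y := by rw [T.RQ.inner_map_map, T.JJ.inner_map]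

theorem RQ_JQ (x : T.HQ) : T.RQ (T.JQ x) = T.JQ (T.RQ x) := by
  change T.RQ (T.RQ (T.JJ x)) = T.RQ (T.JJ (T.RQ x))
  rw [T.RQ_JJ x]

/-- The enveloping CAR algebra `CAR(H_Q, J_Q)`. -/
abbrev Env : Type (u + 1) := CAR T.JQ

/-- The Grassmann-Fermi field operators `G(f) = B(f ⊕ 0)`. -/
def G : H →ₗ[ℂ] T.Env :=
  field T.JQ ∘ₗ ((WithLp.linearEquiv 2 ℂ (H × T.perpSpace)).symm : _ →ₗ[ℂ] T.HQ) ∘ₗ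
    LinearMap.inl ℂ H T.perpSpace

/-- The GAR algebra: the norm-closed unital subalgebra generated by the `G(f)`, `f ∈ H`. -/
def GAR : Subalgebra ℂ T.Env := (Algebra.adjoin ℂ (Set.range T.G)).topologicalClosure

instance instRingGAR : Ring T.GAR := inferInstance

instance instAlgebraGAR : Algebra ℂ T.GAR := inferInstance

/-- The Grassmann part: the norm-closed unital subalgebra generated by the `G(Q^⊥ f)`. -/
def grassmannPart : Subalgebra ℂ T.Env :=
  (Algebra.adjoin ℂ (Set.range fun f => T.G (T.Qperp f))).topologicalClosure

/-- The norm-closed unital subalgebra generated by the `G(Q f)`. -/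
def fermionicSubalgebra : Subalgebra ℂ T.Env :=
  (Algebra.adjoin ℂ (Set.range fun f => T.G (T.Q f))).topologicalClosure

theorem fermionic_le : T.fermionicSubalgebra ≤ T.GAR := by
  refine closure_mono (Algebra.adjoin_mono ?_)
  rintro _ ⟨f, rfl⟩
  exact ⟨T.Q f, rfl⟩

theorem star_G_Q (f : H) : star (T.G (T.Q f)) = T.G (T.Q (T.J f)) := by
  refine (star_field _).trans (congrArg (field T.JQ) ?_)
  refine T.HQ_ext ?_ ?_
  · change T.Q (T.J (T.Q f)) + T.J 0 = T.Q (T.J f)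
    have : T.J 0 = 0 := by simpa using T.J.map_smul 0 0
    rw [this, add_zero, T.comm, Q_Q, T.comm]
  · change T.Qperp (T.J (T.Q f)) = 0
    rw [T.Qperp_J, T.Qperp_apply, Q_Q, sub_self]
    simpa using T.J.map_smul 0 0

/-- The fermionic part of the GAR algebra, with the C*-adjoint of the enveloping algebra, under
which it is stable. It is the CAR algebra of `(QH, QJ)` inside the enveloping algebra. -/
def fermionicPart : StarSubalgebra ℂ T.Env where
  toSubalgebra := T.fermionicSubalgebra
  star_mem' {a} ha := by
    refine map_mem_closure continuous_star ha fun y hy => ?_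
    change star y ∈ Algebra.adjoin ℂ (Set.range fun f => T.G (T.Q f))
    induction hy using Algebra.adjoin_induction with
    | mem x hx =>
      obtain ⟨f, rfl⟩ := hx
      exact Algebra.subset_adjoin ⟨T.J f, (T.star_G_Q f).symm⟩
    | algebraMap r =>
      rw [← algebraMap_star_comm]
      exact Subalgebra.algebraMap_mem _ _
    | add x y _ _ hx hy => rw [star_add]; exact add_mem hx hy
    | mul x y _ _ hx hy => rw [star_mul]; exact mul_mem hy hx

/-- The inclusion of the fermionic part into the GAR algebra. -/
def incl (A : T.fermionicPart) : T.GAR := ⟨A, T.fermionic_le A.2⟩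

/-- The adjoint `⋆`, as an operation of the enveloping algebra: the C*-adjoint followed by the
*-automorphism `B(x) ↦ B(R_Q x)`. -/
def envAdj (A : T.Env) : T.Env :=
  ⟨bogoliubovProd T.RQ T.RQ_JQ (star A : T.Env), bogoliubovProd_mem _ _ (star A).2⟩

theorem envAdj_add (A B : T.Env) : T.envAdj (A + B) = T.envAdj A + T.envAdj B := by
  apply Subtype.ext
  simp [envAdj]

theorem envAdj_mul (A B : T.Env) : T.envAdj (A * B) = T.envAdj B * T.envAdj A := by
  apply Subtype.ext
  simp [envAdj]

theorem envAdj_smul (c : ℂ) (A : T.Env) : T.envAdj (c • A) = conj c • T.envAdj A := by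
  apply Subtype.ext
  simp [envAdj]

theorem envAdj_one : T.envAdj 1 = 1 := by
  apply Subtype.ext
  simp [envAdj]

theorem envAdj_field (x : T.HQ) : T.envAdj (field T.JQ x) = field T.JQ (T.JJ x) := by
  apply Subtype.ext
  change bogoliubovProd T.RQ T.RQ_JQ (star (fieldProd T.JQ x)) = fieldProd T.JQ (T.JJ x)
  rw [star_fieldProd, bogoliubovProd_field]
  exact congrArg _ (T.RQ_RQ (T.JJ x))

theorem envAdj_G (f : H) : T.envAdj (T.G f) = T.G (T.J f) := by
  refine (T.envAdj_field _).trans (congrArg (field T.JQ) ?_)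
  refine T.HQ_ext ?_ ?_
  · rfl
  · change T.J 0 = 0
    simpa using T.J.map_smul 0 0

theorem continuous_envAdj : Continuous T.envAdj :=
  ((continuous_bogoliubovProd T.RQ T.RQ_JQ).comp
    (continuous_subtype_val.comp continuous_star)).subtype_mk _

theorem envAdj_envAdj (A : T.Env) : T.envAdj (T.envAdj A) = A := by
  apply Subtype.ext
  ext ρ
  change star (star ((A : CARProd T.JQ) ((ρ.pullback T.RQ T.RQ_JQ).pullback T.RQ T.RQ_JQ))) =
    (A : CARProd T.JQ) ρ
  have h : (ρ.pullback T.RQ T.RQ_JQ).pullback T.RQ T.RQ_JQ = ρ := by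
    have h2 : (ρ.b ∘ₗ T.RQ.toLinearMap) ∘ₗ T.RQ.toLinearMap = ρ.b := by
      ext x
      exact congrArg ρ.b (T.RQ_RQ x)
    cases ρ
    simp only [CARRep.pullback] at h2 ⊢
    congr
  rw [star_star]
  exact eq_of_heq (congr_arg_heq (fun σ => (A : CARProd T.JQ) σ) h)

theorem envAdj_mem {A : T.Env} (hA : A ∈ T.GAR) : T.envAdj A ∈ T.GAR := by
  refine map_mem_closure T.continuous_envAdj hA fun y hy => ?_
  change T.envAdj y ∈ Algebra.adjoin ℂ (Set.range T.G)
  induction hy using Algebra.adjoin_induction with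
  | mem x hx =>
    obtain ⟨f, rfl⟩ := hx
    exact Algebra.subset_adjoin ⟨T.J f, (T.envAdj_G f).symm⟩
  | algebraMap r =>
    rw [Algebra.algebraMap_eq_smul_one, envAdj_smul, envAdj_one]
    exact Subalgebra.smul_mem _ (one_mem _) _
  | add x y _ _ hx hy => rw [envAdj_add]; exact add_mem hx hy
  | mul x y _ _ hx hy => rw [envAdj_mul]; exact mul_mem hy hx

/-- The adjoint `⋆` of the GAR algebra: the continuous conjugate linear involution that
reverses products and satisfies `G(f)⋆ = G(Jf)`. -/
instance instStarRingGAR : StarRing T.GAR where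
  star A := ⟨T.envAdj A, T.envAdj_mem A.2⟩
  star_involutive A := Subtype.ext (T.envAdj_envAdj A)
  star_mul A B := Subtype.ext (T.envAdj_mul A B)
  star_add A B := Subtype.ext (T.envAdj_add A B)

instance instStarModuleGAR : StarModule ℂ T.GAR where
  star_smul c A := Subtype.ext (T.envAdj_smul c A)

instance instContinuousStarGAR : ContinuousStar T.GAR where
  continuous_star := (T.continuous_envAdj.comp continuous_subtype_val).subtype_mk _

/-- The selfadjoint nilpotent operators in the Grassmann part. -/
def selfAdjointNilpotents : Set T.GAR :=
  {Z | (Z : T.Env) ∈ T.grassmannPart ∧ IsSelfAdjoint Z ∧ IsNilpotent Z}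

/-- The norm-closed two-sided ideal of the GAR algebra generated by the selfadjoint nilpotent
operators in the Grassmann part. -/
def nilpotentIdeal : Set T.GAR :=
  closure (TwoSidedIdeal.span T.selfAdjointNilpotents : Set T.GAR)

end GARData

/-- A positive linear functional on a *-algebra: `ω(A⋆ A)` is real and nonnegative. No continuity
is assumed. -/
def IsPositiveFunctional {A : Type*} [Ring A] [StarRing A] [Algebra ℂ A] (ω : A →ₗ[ℂ] ℂ) : Prop :=
  ∀ a, 0 ≤ (ω (star a * a)).re ∧ (ω (star a * a)).im = 0

end GAR

end GrassmannCAR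

end

/-! The homomorphism is `body`, determined by G(f) ↦ G(Qf); the main point is that it is contractive
on polynomials in the fields. For |z| = 1 the assignment G(f) ↦ G(Qf) + z G(Q^⊥ f) is implemented by
a Bogoliubov homomorphism (`gauge`), hence does not increase norms. Applied to a fixed polynomial it
gives an entire function of z whose value at 0 is the polynomial in the G(Qf), so the maximum
modulus principle bounds the latter (`norm_snd_le_of_mem_graph`). The closed graph is therefore the
graph of a contraction on all of the GAR algebra. It sends the Grassmann part to scalars, and a
nilpotent scalar is zero, so the nilpotent ideal is annihilated.

For positive functionals, two facts combine. The GAR algebra is a Banach *-algebra with contractive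
involution, so positive functionals are bounded (`norm_apply_le`). If Z is selfadjoint with Z² = 0,
a positive functional kills every C Z D (`apply_mul_mul_eq_zero`); the fields G(Q^⊥ f) with Jf = f
are of this kind and span the others. Thus ω does not distinguish a polynomial in the fields from
its image, and continuity extends this to the whole algebra. The functional on the fermionic part is
the restriction of ω. -/

noncomputable section

namespace GrassmannCAR

universe u

/-! ### Automatic continuity of positive functionals on Banach *-algebras -/

section PositiveFunctional

variable {A : Type*} [NormedRing A] [StarRing A] [NormedAlgebra ℂ A]

/-- In a Banach *-algebra with continuous involution, `1 - X` has a selfadjoint square root when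
`X` is selfadjoint and small. -/
theorem exists_isSelfAdjoint_mul_self_eq_one_sub [StarModule ℂ A] [CompleteSpace A]
    [ContinuousStar A] {X : A} (hX : IsSelfAdjoint X) (h : ‖X‖ ≤ 3 / 4) :
    ∃ Y : A, IsSelfAdjoint Y ∧ Y * Y = 1 - X := by
  -- With Y = 1 - T the equation Y² = 1 - X becomes T = (X + T²)/2. This map preserves the ball of
  -- radius 1/2, because (3/4 + 1/4)/2 = 1/2, and has Lipschitz constant at most (‖T‖ + ‖S‖)/2 ≤ 1/2
  -- there. Selfadjointness is a closed condition that the map preserves, so the fixed point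
  -- inherits it.
  set s : Set A := Metric.closedBall 0 (1 / 2) ∩ {T | star T = T}
  have hs : IsComplete s :=
    (Metric.isClosed_closedBall.inter (isClosed_eq continuous_star continuous_id)).isComplete
  set F : A → A := fun T => (1 / 2 : ℂ) • (X + T * T)
  have hF : ∀ B : A, ‖(1 / 2 : ℂ) • B‖ = 1 / 2 * ‖B‖ := fun B => by rw [norm_smul]; norm_num
  have hmaps : Set.MapsTo F s s := by
    rintro T ⟨hT, hT'⟩
    rw [mem_closedBall_zero_iff] at hT
    refine ⟨?_, ?_⟩
    · rw [mem_closedBall_zero_iff, hF]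
      have h1 := norm_add_le X (T * T)
      have h2 := norm_mul_le T T
      nlinarith [norm_nonneg T]
    · change star ((1 / 2 : ℂ) • (X + T * T)) = (1 / 2 : ℂ) • (X + T * T)
      rw [star_smul, star_add, star_mul, hX.star_eq, show star T = T from hT']
      simp
  have hcontr : ContractingWith (1 / 2) (Set.MapsTo.restrict F s s hmaps) := by
    refine ⟨by norm_num, LipschitzWith.of_dist_le_mul ?_⟩
    rintro ⟨T, hT, _⟩ ⟨S, hS, _⟩
    rw [mem_closedBall_zero_iff] at hT hS
    change dist (F T) (F S) ≤ _ * dist T S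
    rw [dist_eq_norm, dist_eq_norm, ← smul_sub, hF]
    have h0 : X + T * T - (X + S * S) = T * (T - S) + (T - S) * S := by noncomm_ring
    have h1 := norm_add_le (T * (T - S)) ((T - S) * S)
    have h2 := norm_mul_le T (T - S)
    have h3 := norm_mul_le (T - S) S
    rw [h0]
    push_cast
    nlinarith [norm_nonneg (T - S)]
  obtain ⟨T, ⟨-, hT⟩, hfix, -⟩ := hcontr.exists_fixedPoint' hs hmaps (x := (0 : A))
    ⟨by simp, by simp⟩ (edist_ne_top _ _)
  have h2 : X + T * T = (2 : ℂ) • T := by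
    nth_rewrite 3 [← show F T = T from hfix]
    rw [smul_smul]
    norm_num
  refine ⟨1 - T, ?_, ?_⟩
  · rw [IsSelfAdjoint, star_sub, star_one, show star T = T from hT]
  · rw [eq_sub_of_add_eq h2, two_smul]
    noncomm_ring

namespace IsPositiveFunctional

variable {ω : A →ₗ[ℂ] ℂ}

/-- A positive functional on a Banach *-algebra is bounded on selfadjoint elements. -/
theorem norm_apply_le_of_isSelfAdjoint [StarModule ℂ A] [CompleteSpace A] [ContinuousStar A]
    (hω : IsPositiveFunctional ω) {X : A} (hX : IsSelfAdjoint X) :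
    ‖ω X‖ ≤ 2 * (ω 1).re * ‖X‖ := by
  have h1 : 0 ≤ (ω 1).re ∧ (ω 1).im = 0 := by simpa using hω 1
  -- If S² = 1 - Y with S selfadjoint, positivity at S says that ω(1) - ω(Y) is real and
  -- nonnegative.
  have small : ∀ Y : A, IsSelfAdjoint Y → ‖Y‖ ≤ 3 / 4 →
      (ω Y).re ≤ (ω 1).re ∧ (ω Y).im = 0 := fun Y hY hn => by
    obtain ⟨S, hS, hSS⟩ := exists_isSelfAdjoint_mul_self_eq_one_sub hY hn
    have h2 := hω S
    rw [hS.star_eq, hSS, map_sub, Complex.sub_re, Complex.sub_im] at h2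
    exact ⟨by linarith, by linarith⟩
  have small' : ∀ Y : A, IsSelfAdjoint Y → ‖Y‖ ≤ 3 / 4 → ‖ω Y‖ ≤ (ω 1).re := fun Y hY hn => by
    have h2 := small Y hY hn
    have h3 := small (-Y) hY.neg (by rwa [norm_neg])
    rw [map_neg, Complex.neg_re] at h3
    rw [show ω Y = ((ω Y).re : ℂ) from Complex.ext rfl (by simp [h2.2]), Complex.norm_real,
      Real.norm_eq_abs, abs_le]
    exact ⟨by linarith, h2.1⟩
  rcases eq_or_ne X 0 with rfl | hX0
  · simp
  have hpos : 0 < ‖X‖ := norm_pos_iff.2 hX0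
  -- Rescaling to norm 1/2, below the threshold 3/4, produces the factor 2 of the bound.
  set c : ℝ := 1 / (2 * ‖X‖)
  have hc : 0 < c := by positivity
  have hcX : c * ‖X‖ = 1 / 2 := by simp only [c]; field_simp
  have hsa : IsSelfAdjoint ((c : ℂ) • X) := by
    rw [IsSelfAdjoint, star_smul, hX.star_eq]
    simp
  have h4 := small' _ hsa (by
    rw [norm_smul, Complex.norm_real, Real.norm_of_nonneg hc.le, hcX]; norm_num)
  rw [map_smul, norm_smul, Complex.norm_real, Real.norm_of_nonneg hc.le] at h4
  have h5 := mul_le_mul_of_nonneg_right h4 (by positivity : 0 ≤ 2 * ‖X‖)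
  have h6 : c * ‖ω X‖ * (2 * ‖X‖) = ‖ω X‖ := by
    calc _ = 2 * (c * ‖X‖) * ‖ω X‖ := by ring
      _ = _ := by rw [hcX]; ring
  linarith

/-- Automatic continuity of positive functionals. -/
theorem norm_apply_le [StarModule ℂ A] [CompleteSpace A] [ContinuousStar A]
    (hω : IsPositiveFunctional ω) (hstar : ∀ X : A, ‖star X‖ ≤ ‖X‖) (X : A) :
    ‖ω X‖ ≤ 4 * (ω 1).re * ‖X‖ := by
  have h1 : 0 ≤ (ω 1).re := by simpa using (hω 1).1
  -- X + X⋆ and i(X - X⋆) are selfadjoint of norm at most 2‖X‖, whence 4 = 2 · 2; X is half of a sum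
  -- of these two with coefficients of modulus one.
  have key : ∀ Y : A, IsSelfAdjoint Y → ‖Y‖ ≤ 2 * ‖X‖ → ‖ω Y‖ ≤ 4 * (ω 1).re * ‖X‖ :=
    fun Y hY hn => (hω.norm_apply_le_of_isSelfAdjoint hY).trans (by nlinarith)
  have hre := key (X + star X) (IsSelfAdjoint.add_star_self X)
    ((norm_add_le _ _).trans (by linarith [hstar X]))
  have him := key (Complex.I • (X - star X)) (by
      rw [IsSelfAdjoint, star_smul, star_sub, star_star]
      simp [smul_sub, neg_add_eq_sub])
    (by
      rw [norm_smul, Complex.norm_I, one_mul]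
      exact (norm_sub_le _ _).trans (by linarith [hstar X]))
  have h2 : X = (1 / 2 : ℂ) • ((X + star X) + (-Complex.I) • (Complex.I • (X - star X))) := by
    rw [smul_smul, neg_mul, Complex.I_mul_I, neg_neg, one_smul, add_add_sub_cancel, ← two_smul ℂ,
      smul_smul]
    norm_num
  have h3 : ‖ω X‖ = 1 / 2 * ‖ω (X + star X) + -Complex.I * ω (Complex.I • (X - star X))‖ := by
    conv_lhs => rw [h2]
    rw [map_smul, map_add, map_smul _ (-Complex.I), norm_smul, smul_eq_mul]
    norm_num
  have h4 := norm_add_le (ω (X + star X)) (-Complex.I * ω (Complex.I • (X - star X)))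
  rw [norm_mul, norm_neg, Complex.norm_I, one_mul] at h4
  linarith

end IsPositiveFunctional

end PositiveFunctional

/-! ### Positive functionals and selfadjoint elements of square zero -/

namespace IsPositiveFunctional

variable {A : Type*} [Ring A] [StarRing A] [Algebra ℂ A] {ω : A →ₗ[ℂ] ℂ}

/-- This is the degenerate case of Cauchy–Schwarz. In ω((B + cZ)⋆(B + cZ)) the quadratic term
vanishes, so for c = t and c = it the real part is affine in t; being nonnegative for all t, it has
slope zero. Vanishing of the imaginary part supplies the remaining equations for ω(B⋆Z). -/
theorem apply_mul_eq_zero_of_star_mul_self [StarModule ℂ A] (hω : IsPositiveFunctional ω) {Z : A}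
    (hZ : ω (star Z * Z) = 0) (X : A) : ω (X * Z) = 0 := by
  set B := star X
  have expand : ∀ c : ℂ, ω (star (B + c • Z) * (B + c • Z)) =
      ω (star B * B) + c * ω (star B * Z) + conj c * ω (star Z * B) := fun c => by
    have : star (B + c • Z) * (B + c • Z) =
        star B * B + c • (star B * Z) + conj c • (star Z * B)
          + (conj c * c) • (star Z * Z) := by
      rw [star_add, star_smul]
      simp only [add_mul, mul_add, smul_mul_assoc, mul_smul_comm, smul_add, smul_smul, starRingEnd_apply]
      rw [mul_comm c]
      abel
    rw [this]
    simp [hZ]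
  have real : ∀ t : ℝ, 0 ≤ (ω (star B * B)).re +
        t * ((ω (star B * Z)).re + (ω (star Z * B)).re) ∧
      (ω (star B * B)).im + t * ((ω (star B * Z)).im + (ω (star Z * B)).im) = 0 := fun t => by
    have h := hω (B + (t : ℂ) • Z)
    rw [expand] at h
    simp at h
    exact ⟨by linarith [h.1], by linarith [h.2]⟩
  have imag : ∀ t : ℝ, 0 ≤ (ω (star B * B)).re +
        t * ((ω (star Z * B)).im - (ω (star B * Z)).im) ∧
      (ω (star B * B)).im + t * ((ω (star B * Z)).re - (ω (star Z * B)).re) = 0 := fun t => by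
    have h := hω (B + (t * Complex.I : ℂ) • Z)
    rw [expand] at h
    simp at h
    exact ⟨by linarith [h.1], by linarith [h.2]⟩
  have vanish : ∀ K a : ℝ, (∀ t : ℝ, 0 ≤ K + t * a) → a = 0 := fun K a h => by
    by_contra ha
    have := h (-(K + 1) / a)
    rw [div_mul_cancel₀ _ ha] at this
    linarith
  have r := vanish _ _ fun t => (real t).1
  have i := vanish _ _ fun t => (imag t).1
  have e1 := (real 1).2
  have e2 := (imag 1).2
  have e0 := (hω B).2
  rw [← star_star X]
  refine Complex.ext ?_ ?_
  · rw [Complex.zero_re]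
    linarith
  · rw [Complex.zero_im]
    linarith

theorem conjugate (hω : IsPositiveFunctional ω) (D : A) :
    IsPositiveFunctional (ω ∘ₗ LinearMap.mulLeft ℂ (star D) ∘ₗ LinearMap.mulRight ℂ D) := by
  intro X
  have h := hω (X * D)
  rw [star_mul, mul_assoc, ← mul_assoc (star X)] at h
  exact h

/-- A positive functional vanishes on the two-sided ideal generated by a selfadjoint element of
square zero. -/
theorem apply_mul_mul_eq_zero [StarModule ℂ A] (hω : IsPositiveFunctional ω) {Z : A} (hZ : IsSelfAdjoint Z)
    (hZ2 : Z * Z = 0) (C D : A) : ω (C * Z * D) = 0 := by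
  have hz : star Z * Z = 0 := by rw [hZ.star_eq, hZ2]
  have left : ∀ X, ω (X * Z) = 0 := fun X =>
    hω.apply_mul_eq_zero_of_star_mul_self (by rw [hz, map_zero]) X
  -- Conjugation by D only yields zeros of the form ω(D⋆ C Z D). Comparing D with D + 1 removes the
  -- factor D⋆: of the four terms in the expansion, all but ω(C Z D) are already known to vanish.
  have h1 : ω (star (D + 1) * (C * Z * (D + 1))) = 0 :=
    (hω.conjugate (D + 1)).apply_mul_eq_zero_of_star_mul_self (by rw [hz, map_zero]) C
  have h2 : ω (star D * (C * Z * D)) = 0 :=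
    (hω.conjugate D).apply_mul_eq_zero_of_star_mul_self (by rw [hz, map_zero]) C
  have h3 : star (D + 1) * (C * Z * (D + 1)) =
      star D * (C * Z * D) + star D * C * Z + C * Z * D + C * Z := by
    rw [star_add, star_one]
    noncomm_ring
  rw [h3, map_add, map_add, map_add, h2, left, left] at h1
  simpa using h1

end IsPositiveFunctional

/-! ### The GAR algebra: gauge action, body homomorphism and positive functionals -/

namespace GARData

variable {H : Type u} [NormedAddCommGroup H] [InnerProductSpace ℂ H] [CompleteSpace H]
  (T : GARData H)

theorem Q_Qperp (f : H) : T.Q (T.Qperp f) = 0 := by rw [Qperp_apply, map_sub, Q_Q, sub_self]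

theorem Qperp_Q (f : H) : T.Qperp (T.Q f) = 0 := by rw [Qperp_apply, Q_Q, sub_self]

theorem Q_add_Qperp (f : H) : T.Q f + T.Qperp f = f := by rw [Qperp_apply]; abel

theorem J_zero : T.J 0 = 0 := by simpa using T.J.map_smul 0 0

/-! The gauge action of the unit circle, and the homomorphism it induces. -/

/-- The gauge transformation `f ⊕ h ↦ (Q f + z Q^⊥ f) ⊕ conj z h` for `|z| = 1`. -/
def gauge (z : ℂ) (hz : ‖z‖ = 1) : T.HQ →ₗᵢ[ℂ] T.HQ :=
  LinearMap.isometryOfInner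
    { toFun := fun x => WithLp.toLp 2 (T.Q x.fst + z • T.Qperp x.fst, conj z • x.snd)
      map_add' := fun x y => by
        refine T.HQ_ext ?_ ?_
        · change T.Q (x.fst + y.fst) + z • T.Qperp (x.fst + y.fst) =
            (T.Q x.fst + z • T.Qperp x.fst) + (T.Q y.fst + z • T.Qperp y.fst)
          rw [map_add, map_add, smul_add]
          abel
        · simp
      map_smul' := fun c x => by
        refine T.HQ_ext ?_ ?_
        · simp [smul_comm z c]
        · simp [smul_comm (conj z) c] }
    (fun x y => by
      have h1 : ⟪T.Q x.fst, T.Qperp y.fst⟫_ℂ = 0 := by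
        rw [inner_Q_left, Q_Qperp, inner_zero_right]
      have h2 : ⟪T.Qperp x.fst, T.Q y.fst⟫_ℂ = 0 := by
        rw [← inner_Q_left, Q_Qperp, inner_zero_left]
      have h3 : ⟪x.fst, y.fst⟫_ℂ =
          ⟪T.Q x.fst, T.Q y.fst⟫_ℂ + ⟪T.Qperp x.fst, T.Qperp y.fst⟫_ℂ := by
        conv_lhs => rw [← T.Q_add_Qperp x.fst, ← T.Q_add_Qperp y.fst]
        rw [inner_add_left, inner_add_right, inner_add_right, h1, h2]
        ring
      have h4 : conj z * z = 1 := by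
        rw [Complex.conj_mul', hz]
        norm_num
      simp only [LinearMap.coe_mk, AddHom.coe_mk, WithLp.prod_inner_apply, Submodule.coe_inner,
        WithLp.ofLp_fst, WithLp.ofLp_snd, inner_add_left, inner_add_right,
        inner_smul_left, inner_smul_right, h1, h2, h3, Complex.conj_conj]
      linear_combination (⟪T.Qperp x.fst, T.Qperp y.fst⟫_ℂ + ⟪(x.snd : H), (y.snd : H)⟫_ℂ) * h4)

theorem gauge_fst (z : ℂ) (hz : ‖z‖ = 1) (x : T.HQ) :
    (T.gauge z hz x).fst = T.Q x.fst + z • T.Qperp x.fst := rfl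

theorem gauge_snd (z : ℂ) (hz : ‖z‖ = 1) (x : T.HQ) :
    (T.gauge z hz x).snd = conj z • x.snd := rfl

theorem JQ_fst (x : T.HQ) : (T.JQ x).fst = T.Q (T.J x.fst) + T.J (x.snd : H) := rfl

theorem coe_JQ_snd (x : T.HQ) : ((T.JQ x).snd : H) = T.Qperp (T.J x.fst) := rfl

/-- J_Q exchanges Q^⊥H ⊕ 0 and 0 ⊕ Q^⊥H conjugate linearly, so the phase z on one forces conj z on
the other. -/
theorem gauge_JQ (z : ℂ) (hz : ‖z‖ = 1) (x : T.HQ) :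
    T.gauge z hz (T.JQ x) = T.JQ (T.gauge z hz x) := by
  refine T.HQ_ext ?_ ?_
  · have h1 : T.Q (T.J (T.Q x.fst)) = T.Q (T.J x.fst) := by rw [T.comm, T.comm, Q_Q]
    have h2 : T.Q (T.J (T.Qperp x.fst)) = 0 := by rw [T.comm, Q_Qperp, J_zero]
    have h3 := T.Q_of_mem (T.J_mem x.snd.2)
    have h4 := T.Qperp_of_mem (T.J_mem x.snd.2)
    rw [gauge_fst, JQ_fst, JQ_fst, gauge_fst, gauge_snd, T.J.map_add, map_add, map_add, map_add,
      Q_Q, h3, h4, Qperp_Q, h1, T.J.map_smul, map_smul, h2, Submodule.coe_smul, T.J.map_smul,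
      Complex.conj_conj]
    simp
  · have h1 : T.Qperp (T.Qperp x.fst) = T.Qperp x.fst := T.Qperp_of_mem ⟨_, rfl⟩
    rw [gauge_snd, Submodule.coe_smul, coe_JQ_snd, coe_JQ_snd, gauge_fst, T.J.map_add, map_add,
      T.J.map_smul, map_smul, Qperp_J, Qperp_J, Qperp_J, Qperp_Q, J_zero, zero_add, h1]

theorem gauge_inl (z : ℂ) (hz : ‖z‖ = 1) (f : H) :
    bogoliubovProd (T.gauge z hz) (T.gauge_JQ z hz) (T.G f : CARProd T.JQ) =
      (T.G (T.Q f) : CARProd T.JQ) + z • (T.G (T.Qperp f) : CARProd T.JQ) := by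
  have h : T.G (T.Q f) + z • T.G (T.Qperp f) = T.G (T.Q f + z • T.Qperp f) := by
    rw [map_add, map_smul]
  refine Eq.trans ?_ (congrArg Subtype.val h.symm)
  refine congrArg (fieldProd T.JQ) (T.HQ_ext rfl ?_)
  change ((conj z • (0 : T.perpSpace) : T.perpSpace) : H) = 0
  simp

/-! ### Contractivity and the closed graph -/

/-- The graph of the homomorphism `G(f) ↦ G(Q f)`. -/
def graph : Subalgebra ℂ (T.Env × T.Env) :=
  (Algebra.adjoin ℂ (Set.range fun f => (T.G f, T.G (T.Q f)))).topologicalClosure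

/-- The function p replaces each G(f) by G(Qf) + z G(Q^⊥ f), for every complex z. On the unit circle
this is the gauge homomorphism, which controls the norm; at the centre it is the second component.
-/
theorem exists_differentiable_of_mem_adjoin {x : T.Env × T.Env}
    (hx : x ∈ Algebra.adjoin ℂ (Set.range fun f => (T.G f, T.G (T.Q f)))) :
    ∃ p : ℂ → CARProd T.JQ, Differentiable ℂ p ∧ p 0 = x.2 ∧
      ∀ z (hz : ‖z‖ = 1), p z = bogoliubovProd (T.gauge z hz) (T.gauge_JQ z hz) x.1 := by
  induction hx using Algebra.adjoin_induction with
  | mem x hx =>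
    obtain ⟨f, rfl⟩ := hx
    refine ⟨fun z => (T.G (T.Q f) : CARProd T.JQ) + z • (T.G (T.Qperp f) : CARProd T.JQ),
      by fun_prop, by simp, fun z hz => (T.gauge_inl z hz f).symm⟩
  | algebraMap r =>
    refine ⟨fun _ => algebraMap ℂ _ r, by fun_prop, rfl, fun z hz => ?_⟩
    exact ((bogoliubovProd (T.gauge z hz) (T.gauge_JQ z hz)).toAlgHom.commutes r).symm
  | add x y _ _ hx hy =>
    obtain ⟨p, hp, hp0, hp1⟩ := hx
    obtain ⟨q, hq, hq0, hq1⟩ := hy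
    refine ⟨fun z => p z + q z, hp.add hq, by simp [hp0, hq0], fun z hz => ?_⟩
    simp [hp1 z hz, hq1 z hz]
  | mul x y _ _ hx hy =>
    obtain ⟨p, hp, hp0, hp1⟩ := hx
    obtain ⟨q, hq, hq0, hq1⟩ := hy
    refine ⟨fun z => p z * q z, hp.mul hq, by simp [hp0, hq0], fun z hz => ?_⟩
    simp [hp1 z hz, hq1 z hz]

/-- The homomorphism `G(f) ↦ G(Q f)` is contractive, by the maximum modulus principle. -/
theorem norm_snd_le_of_mem_graph {x : T.Env × T.Env} (hx : x ∈ T.graph) : ‖x.2‖ ≤ ‖x.1‖ := by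
  refine closure_minimal (fun y hy => ?_)
    (isClosed_le (continuous_snd.norm) (continuous_fst.norm)) hx
  obtain ⟨p, hp, hp0, hp1⟩ := T.exists_differentiable_of_mem_adjoin hy
  change ‖(y.2 : CARProd T.JQ)‖ ≤ ‖(y.1 : CARProd T.JQ)‖
  rw [← hp0]
  refine Complex.norm_le_of_forall_mem_frontier_norm_le (U := Metric.ball 0 1)
    Metric.isBounded_ball hp.diffContOnCl (fun z hz => ?_) (subset_closure (by simp))
  rw [frontier_ball _ one_ne_zero, mem_sphere_zero_iff_norm] at hz
  rw [hp1 z hz]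
  exact norm_bogoliubovProd_le _ _ _

theorem fst_mem_of_mem_graph {x : T.Env × T.Env} (hx : x ∈ T.graph) : x.1 ∈ T.GAR := by
  refine map_mem_closure continuous_fst hx fun y hy => ?_
  have : Algebra.adjoin ℂ (Set.range fun f => (T.G f, T.G (T.Q f))) ≤
      (Algebra.adjoin ℂ (Set.range T.G)).comap (AlgHom.fst ℂ T.Env T.Env) := by
    rw [Algebra.adjoin_le_iff]
    rintro _ ⟨f, rfl⟩
    exact Algebra.subset_adjoin ⟨f, rfl⟩
  exact this hy

theorem snd_mem_of_mem_graph {x : T.Env × T.Env} (hx : x ∈ T.graph) :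
    x.2 ∈ T.fermionicPart := by
  refine map_mem_closure continuous_snd hx fun y hy => ?_
  have : Algebra.adjoin ℂ (Set.range fun f => (T.G f, T.G (T.Q f))) ≤
      (Algebra.adjoin ℂ (Set.range fun f => T.G (T.Q f))).comap (AlgHom.snd ℂ T.Env T.Env) := by
    rw [Algebra.adjoin_le_iff]
    rintro _ ⟨f, rfl⟩
    exact Algebra.subset_adjoin ⟨f, rfl⟩
  exact this hy

instance completeSpace_env : CompleteSpace T.Env :=
  IsClosed.completeSpace_coe (hs := isClosed_closure)

instance completeSpace_GAR : CompleteSpace T.GAR :=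
  IsClosed.completeSpace_coe (hs := isClosed_closure)

/-- The product carries the maximum norm, so contractivity makes the first projection of the graph
isometric. Its range is then closed, and it contains all polynomials in the fields. -/
theorem exists_mem_graph {A : T.Env} (hA : A ∈ T.GAR) : ∃ B, (A, B) ∈ T.graph := by
  have hiso : Isometry fun x : T.graph => (x : T.Env × T.Env).1 := by
    refine AddMonoidHomClass.isometry_of_norm
      ((AlgHom.fst ℂ T.Env T.Env).comp T.graph.val) fun x => ?_
    exact (max_eq_left (T.norm_snd_le_of_mem_graph x.2)).symm
  have : CompleteSpace T.graph := IsClosed.completeSpace_coe (hs := isClosed_closure)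
  have hcl : IsClosed (Set.range fun x : T.graph => (x : T.Env × T.Env).1) :=
    hiso.isClosedEmbedding.isClosed_range
  have hle : Algebra.adjoin ℂ (Set.range T.G) ≤
      ((AlgHom.fst ℂ T.Env T.Env).comp T.graph.val).range := by
    rw [Algebra.adjoin_le_iff]
    rintro _ ⟨f, rfl⟩
    exact ⟨⟨(T.G f, T.G (T.Q f)), subset_closure (Algebra.subset_adjoin ⟨f, rfl⟩)⟩, rfl⟩
  obtain ⟨x, hx⟩ := closure_minimal (fun a ha => hle ha) hcl hA
  refine ⟨(x : T.Env × T.Env).2, ?_⟩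
  rw [← show (x : T.Env × T.Env).1 = A from hx]
  exact x.2

theorem graph_right_unique {A B C : T.Env} (hB : (A, B) ∈ T.graph) (hC : (A, C) ∈ T.graph) :
    B = C := by
  have h := T.norm_snd_le_of_mem_graph (sub_mem hB hC)
  simp only [Prod.mk_sub_mk, sub_self, norm_zero] at h
  exact sub_eq_zero.1 (norm_le_zero_iff.1 h)

theorem envAdj_G_Q (f : H) : T.envAdj (T.G (T.Q f)) = star (T.G (T.Q f)) := by
  rw [envAdj_G, star_G_Q, T.comm]

/-- On generators this is G(Q J f) = G(Qf)*, so the homomorphism intertwines `envAdj` with the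
C*-adjoint. -/
theorem star_mem_graph {A B : T.Env} (h : (A, B) ∈ T.graph) :
    (T.envAdj A, star B) ∈ T.graph := by
  refine map_mem_closure (f := fun x : T.Env × T.Env => (T.envAdj x.1, star x.2))
    ((T.continuous_envAdj.comp continuous_fst).prodMk (continuous_star.comp continuous_snd))
    h fun y hy => ?_
  change (T.envAdj y.1, star y.2) ∈
    Algebra.adjoin ℂ (Set.range fun f => (T.G f, T.G (T.Q f)))
  induction hy using Algebra.adjoin_induction with
  | mem x hx =>
    obtain ⟨f, rfl⟩ := hx
    refine Algebra.subset_adjoin ⟨T.J f, ?_⟩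
    change (T.G (T.J f), T.G (T.Q (T.J f))) = (T.envAdj (T.G f), star (T.G (T.Q f)))
    rw [envAdj_G, star_G_Q]
  | algebraMap r =>
    have h1 : T.envAdj (algebraMap ℂ T.Env r) = algebraMap ℂ T.Env (conj r) := by
      rw [Algebra.algebraMap_eq_smul_one, envAdj_smul, envAdj_one,
        ← Algebra.algebraMap_eq_smul_one]
    have h2 : star (algebraMap ℂ T.Env r) = algebraMap ℂ T.Env (conj r) :=
      (algebraMap_star_comm r).symm
    change (T.envAdj (algebraMap ℂ T.Env r), star (algebraMap ℂ T.Env r)) ∈ _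
    rw [h1, h2]
    exact Subalgebra.algebraMap_mem _ (conj r)
  | add x y _ _ hx hy =>
    rw [Prod.fst_add, Prod.snd_add, envAdj_add, star_add]
    exact add_mem hx hy
  | mul x y _ _ hx hy =>
    rw [Prod.fst_mul, Prod.snd_mul, envAdj_mul, star_mul]
    exact mul_mem hy hx

theorem diag_mem_graph {A : T.Env} (hA : A ∈ T.fermionicPart) : (A, A) ∈ T.graph := by
  refine map_mem_closure (f := fun x : T.Env => (x, x)) (by fun_prop) hA fun y hy => ?_
  have : Algebra.adjoin ℂ (Set.range fun f => T.G (T.Q f)) ≤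
      (Algebra.adjoin ℂ (Set.range fun f => (T.G f, T.G (T.Q f)))).comap
        ((AlgHom.id ℂ T.Env).prod (AlgHom.id ℂ T.Env)) := by
    rw [Algebra.adjoin_le_iff]
    rintro _ ⟨f, rfl⟩
    refine Algebra.subset_adjoin ⟨T.Q f, ?_⟩
    change (T.G (T.Q f), T.G (T.Q (T.Q f))) = (T.G (T.Q f), T.G (T.Q f))
    rw [Q_Q]
  exact this hy

/-! ### The body homomorphism -/

/-- The value at `A` of the homomorphism `G(f) ↦ G(Q f)`. -/
def bodyFun (A : T.GAR) : T.Env := (T.exists_mem_graph A.2).choose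

theorem mk_bodyFun_mem_graph (A : T.GAR) : ((A : T.Env), T.bodyFun A) ∈ T.graph :=
  (T.exists_mem_graph A.2).choose_spec

theorem bodyFun_eq {A : T.GAR} {B : T.Env} (h : ((A : T.Env), B) ∈ T.graph) : T.bodyFun A = B :=
  T.graph_right_unique (T.mk_bodyFun_mem_graph A) h

/-- The *-homomorphism `G(f) ↦ G(Q f)` of the GAR algebra onto its fermionic part. -/
def body : T.GAR →⋆ₐ[ℂ] T.fermionicPart where
  toFun A := ⟨T.bodyFun A, T.snd_mem_of_mem_graph (T.mk_bodyFun_mem_graph A)⟩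
  map_one' := Subtype.ext (T.bodyFun_eq (one_mem T.graph))
  map_mul' A B := Subtype.ext
    (T.bodyFun_eq (mul_mem (T.mk_bodyFun_mem_graph A) (T.mk_bodyFun_mem_graph B)))
  map_zero' := Subtype.ext (T.bodyFun_eq (zero_mem T.graph))
  map_add' A B := Subtype.ext
    (T.bodyFun_eq (add_mem (T.mk_bodyFun_mem_graph A) (T.mk_bodyFun_mem_graph B)))
  commutes' r := Subtype.ext (T.bodyFun_eq (T.graph.algebraMap_mem r))
  map_star' A := Subtype.ext (T.bodyFun_eq (T.star_mem_graph (T.mk_bodyFun_mem_graph A)))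

theorem coe_body_eq {A : T.GAR} {B : T.Env} (h : ((A : T.Env), B) ∈ T.graph) :
    (T.body A : T.Env) = B := T.bodyFun_eq h

theorem norm_body_le (A : T.GAR) : ‖T.body A‖ ≤ ‖A‖ :=
  T.norm_snd_le_of_mem_graph (T.mk_bodyFun_mem_graph A)

theorem continuous_body : Continuous T.body :=
  AddMonoidHomClass.continuous_of_bound T.body 1 fun A => by
    rw [one_mul]
    exact T.norm_body_le A

theorem G_mem (f : H) : T.G f ∈ T.GAR := subset_closure (Algebra.subset_adjoin ⟨f, rfl⟩)

theorem coe_incl (A : T.fermionicPart) : (T.incl A : T.Env) = (A : T.Env) := by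
  rw [incl]

theorem incl_mem_graph (A : T.fermionicPart) : ((T.incl A : T.Env), (A : T.Env)) ∈ T.graph := by
  rw [coe_incl]
  exact T.diag_mem_graph A.2

theorem coe_body_incl (A : T.fermionicPart) : (T.body (T.incl A) : T.Env) = (A : T.Env) :=
  T.coe_body_eq (T.incl_mem_graph A)

theorem body_incl (A : T.fermionicPart) : T.body (T.incl A) = A :=
  Subtype.ext (T.coe_body_incl A)

/-! The homomorphism annihilates the nilpotent ideal. -/

theorem grassmannPart_le : T.grassmannPart ≤ T.GAR := by
  refine closure_mono (Algebra.adjoin_mono ?_)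
  rintro _ ⟨f, rfl⟩
  exact ⟨T.Qperp f, rfl⟩

theorem G_mem_graph (f : H) : (T.G f, T.G (T.Q f)) ∈ T.graph :=
  subset_closure (Algebra.subset_adjoin ⟨f, rfl⟩)

theorem exists_scalar_mem_graph {a : T.Env}
    (ha : a ∈ Algebra.adjoin ℂ (Set.range fun f => T.G (T.Qperp f))) :
    ∃ c : ℂ, (a, algebraMap ℂ T.Env c) ∈ T.graph := by
  induction ha using Algebra.adjoin_induction with
  | mem x hx =>
    obtain ⟨f, rfl⟩ := hx
    refine ⟨0, ?_⟩
    have h := T.G_mem_graph (T.Qperp f)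
    rwa [Q_Qperp, map_zero, ← map_zero (algebraMap ℂ T.Env)] at h
  | algebraMap r => exact ⟨r, T.graph.algebraMap_mem r⟩
  | add x y _ _ hx hy =>
    obtain ⟨c, hc⟩ := hx
    obtain ⟨d, hd⟩ := hy
    refine ⟨c + d, ?_⟩
    rw [map_add]
    exact add_mem hc hd
  | mul x y _ _ hx hy =>
    obtain ⟨c, hc⟩ := hx
    obtain ⟨d, hd⟩ := hy
    refine ⟨c * d, ?_⟩
    rw [map_mul]
    exact mul_mem hc hd

/-- The generators G(Q^⊥ f) go to 0, so polynomials in them go to scalars. By contractivity the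
image of a limit is a limit of scalars, and the line ℂ1 is closed since it is finite-dimensional. -/
theorem exists_scalar_mem_graph_of_mem_grassmannPart {a : T.Env} (ha : a ∈ T.grassmannPart) :
    ∃ c : ℂ, (a, algebraMap ℂ T.Env c) ∈ T.graph := by
  obtain ⟨b, hb⟩ := T.exists_mem_graph (T.grassmannPart_le ha)
  have hcl : b ∈ closure (Submodule.span ℂ {(1 : T.Env)} : Set T.Env) := by
    rw [Metric.mem_closure_iff]
    intro δ hδ
    obtain ⟨y, hy, hay⟩ := Metric.mem_closure_iff.1 ha δ hδ
    obtain ⟨c, hc⟩ := T.exists_scalar_mem_graph hy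
    refine ⟨algebraMap ℂ T.Env c, ?_, ?_⟩
    · rw [Algebra.algebraMap_eq_smul_one]
      exact Submodule.smul_mem _ _ (Submodule.mem_span_singleton_self _)
    · rw [dist_eq_norm] at hay ⊢
      exact (T.norm_snd_le_of_mem_graph (sub_mem hb hc)).trans_lt hay
  rw [(Submodule.closed_of_finiteDimensional _).closure_eq] at hcl
  obtain ⟨c, rfl⟩ := Submodule.mem_span_singleton.1 hcl
  refine ⟨c, ?_⟩
  rwa [Algebra.algebraMap_eq_smul_one]

theorem body_eq_zero_of_mem_selfAdjointNilpotents {Z : T.GAR}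
    (hZ : Z ∈ T.selfAdjointNilpotents) : T.body Z = 0 := by
  obtain ⟨hZg, -, n, hn⟩ := hZ
  obtain ⟨c, hc⟩ := T.exists_scalar_mem_graph_of_mem_grassmannPart hZg
  have h : T.body Z = algebraMap ℂ T.fermionicPart c := Subtype.ext (T.coe_body_eq hc)
  have hpow := congrArg T.body hn
  rw [map_pow, map_zero, h, ← map_pow] at hpow
  rcases subsingleton_or_nontrivial T.fermionicPart with _ | _
  · exact Subsingleton.elim _ _
  · rw [map_eq_zero] at hpow
    rw [h, eq_zero_of_pow_eq_zero hpow, map_zero]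

theorem body_eq_zero_of_mem_nilpotentIdeal {Z : T.GAR} (hZ : Z ∈ T.nilpotentIdeal) :
    T.body Z = 0 := by
  have hle : TwoSidedIdeal.span T.selfAdjointNilpotents ≤ TwoSidedIdeal.ker T.body :=
    TwoSidedIdeal.span_le.2 fun Z hZ => (TwoSidedIdeal.mem_ker _).2
      (T.body_eq_zero_of_mem_selfAdjointNilpotents hZ)
  exact closure_minimal (fun Z hZ => (TwoSidedIdeal.mem_ker _).1 (hle hZ))
    (isClosed_eq T.continuous_body continuous_const) hZ

/-! Positive functionals factor through the fermionic part. -/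

/-- The inclusion of the fermionic part into the GAR algebra as a linear map. -/
def inclLinearMap : T.fermionicPart →ₗ[ℂ] T.GAR where
  toFun := T.incl
  map_add' A B := Subtype.ext (by
    rw [Subalgebra.coe_add T.GAR (T.incl A) (T.incl B), coe_incl, coe_incl, coe_incl]
    rfl)
  map_smul' c A := Subtype.ext (by
    rw [RingHom.id_apply, Subalgebra.coe_smul T.GAR c (T.incl A), coe_incl, coe_incl]
    rfl)

theorem inclLinearMap_apply (A : T.fermionicPart) : T.inclLinearMap A = T.incl A := rfl

theorem incl_mul (A B : T.fermionicPart) : T.incl (A * B) = T.incl A * T.incl B :=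
  Subtype.ext (by
    rw [Subalgebra.coe_mul T.GAR (T.incl A) (T.incl B), coe_incl, coe_incl, coe_incl]
    rfl)

/-- The two adjoints agree on the generators G(Qf), and both are continuous, conjugate linear and
product-reversing. Hence positivity for ⋆ restricts to positivity for the C*-adjoint. -/
theorem envAdj_eq_star {a : T.Env} (ha : a ∈ T.fermionicPart) : T.envAdj a = star a := by
  refine closure_minimal (fun y hy => ?_) (isClosed_eq T.continuous_envAdj continuous_star) ha
  change T.envAdj y = star y
  replace hy : y ∈ Algebra.adjoin ℂ (Set.range fun f => T.G (T.Q f)) := hy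
  induction hy using Algebra.adjoin_induction with
  | mem x hx =>
    obtain ⟨f, rfl⟩ := hx
    exact T.envAdj_G_Q f
  | algebraMap r =>
    rw [Algebra.algebraMap_eq_smul_one, envAdj_smul, envAdj_one, star_smul, star_one]
    rfl
  | add x y _ _ hx hy => rw [envAdj_add, star_add, hx, hy]
  | mul x y _ _ hx hy => rw [envAdj_mul, star_mul, hx, hy]

theorem coe_star_GAR (A : T.GAR) : ((star A : T.GAR) : T.Env) = T.envAdj (A : T.Env) := rfl

theorem incl_star (A : T.fermionicPart) : T.incl (star A) = star (T.incl A) :=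
  Subtype.ext (by
    rw [coe_star_GAR, coe_incl, coe_incl, T.envAdj_eq_star A.2]
    rfl)

theorem norm_star_le (A : T.GAR) : ‖star A‖ ≤ ‖A‖ := by
  have h : ‖T.envAdj (A : T.Env)‖ ≤ ‖(star (A : T.Env) : T.Env)‖ :=
    norm_bogoliubovProd_le T.RQ T.RQ_JQ _
  exact h.trans (norm_star (A : T.Env)).le

/-- The field operators `G(f)` as elements of the GAR algebra. -/
def GLinearMap : H →ₗ[ℂ] T.GAR := T.G.codRestrict T.GAR.toSubmodule T.G_mem

theorem star_GLinearMap (f : H) : star (T.GLinearMap f) = T.GLinearMap (T.J f) :=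
  Subtype.ext (T.envAdj_G f)

/-- J_Q maps Q^⊥ f ⊕ 0 into 0 ⊕ Q^⊥H, which is orthogonal to it, so the anticommutator vanishes. -/
theorem G_Qperp_mul_self (f : H) : T.G (T.Qperp f) * T.G (T.Qperp f) = 0 := by
  set x : T.HQ := WithLp.toLp 2 (T.Qperp f, 0)
  have h : T.G (T.Qperp f) * T.G (T.Qperp f) + T.G (T.Qperp f) * T.G (T.Qperp f) =
      ⟪T.JQ x, x⟫_ℂ • (1 : T.Env) := field_anticomm x x
  have h0 : ⟪T.JQ x, x⟫_ℂ = 0 := by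
    have h1 : (T.JQ x).fst = 0 := by
      rw [JQ_fst]
      change T.Q (T.J (T.Qperp f)) + T.J 0 = 0
      rw [T.comm, Q_Qperp, J_zero, add_zero]
    have h2 : x.snd = 0 := rfl
    rw [WithLp.prod_inner_apply, WithLp.ofLp_fst, WithLp.ofLp_snd, h1, WithLp.ofLp_snd, h2,
      inner_zero_left, inner_zero_right, add_zero]
  rw [h0, zero_smul, ← two_smul ℂ] at h
  exact (smul_eq_zero.1 h).resolve_left two_ne_zero

theorem GLinearMap_Qperp_mul_self (f : H) :
    T.GLinearMap (T.Qperp f) * T.GLinearMap (T.Qperp f) = 0 :=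
  Subtype.ext (T.G_Qperp_mul_self f)

variable {T} {ω : T.GAR →ₗ[ℂ] ℂ}

/-- If Jg = g, then G(Q^⊥ g) is selfadjoint of square zero. A general f is a complex combination of
the J-fixed vectors f + Jf and i(f - Jf). -/
theorem apply_mul_G_Qperp_mul (hω : IsPositiveFunctional ω) (f : H) (C D : T.GAR) :
    ω (C * T.GLinearMap (T.Qperp f) * D) = 0 := by
  have real : ∀ g, T.J g = g → ω (C * T.GLinearMap (T.Qperp g) * D) = 0 := fun g hg =>
    hω.apply_mul_mul_eq_zero
      (by rw [IsSelfAdjoint, star_GLinearMap, ← Qperp_J, hg])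
      (T.GLinearMap_Qperp_mul_self g) C D
  have h1 := real (f + T.J f) (by rw [T.J.map_add, T.J.involutive, add_comm])
  have h2 := real (Complex.I • (f - T.J f)) (by
    rw [T.J.map_smul, J_sub, T.J.involutive, Complex.conj_I, neg_smul, ← smul_neg, neg_sub])
  have hf : f = (1 / 2 : ℂ) • (f + T.J f) +
      (-(1 / 2) * Complex.I) • (Complex.I • (f - T.J f)) := by
    rw [smul_smul, mul_assoc, Complex.I_mul_I, mul_neg_one, neg_neg, ← smul_add,
      add_add_sub_cancel, ← two_smul ℂ, smul_smul]
    norm_num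
  rw [hf]
  simp only [map_add T.Qperp, map_smul T.Qperp, map_add T.GLinearMap, map_smul T.GLinearMap,
    mul_add, add_mul, mul_smul_comm, smul_mul_assoc, map_add ω, map_smul ω] at h1 h2 ⊢
  rw [h1, h2, smul_zero, smul_zero, add_zero]

theorem apply_mul_sub_mul {a b : T.Env} (ha : a ∈ T.GAR) (hb : b ∈ T.GAR)
    (hω : IsPositiveFunctional ω)
    (hab : (a, b) ∈ Algebra.adjoin ℂ (Set.range fun f => (T.G f, T.G (T.Q f)))) (C D : T.GAR) :
    ω (C * (⟨a, ha⟩ - ⟨b, hb⟩) * D) = 0 := by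
  -- Lifts to the GAR algebra are carried existentially through the induction, and the factors C and
  -- D stay arbitrary because the product step changes them.
  suffices h : ∀ x ∈ Algebra.adjoin ℂ (Set.range fun f => (T.G f, T.G (T.Q f))),
      ∃ A B : T.GAR, (A : T.Env) = x.1 ∧ (B : T.Env) = x.2 ∧
        ∀ C D, ω (C * (A - B) * D) = 0 by
    obtain ⟨A, B, hA, hB, h⟩ := h _ hab
    have hA' : A = ⟨a, ha⟩ := Subtype.ext hA
    have hB' : B = ⟨b, hb⟩ := Subtype.ext hB
    rw [← hA', ← hB']
    exact h C D
  intro x hx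
  induction hx using Algebra.adjoin_induction with
  | mem x hx =>
    obtain ⟨f, rfl⟩ := hx
    refine ⟨T.GLinearMap f, T.GLinearMap (T.Q f), rfl, rfl, fun C D => ?_⟩
    rw [← map_sub, ← Qperp_apply]
    exact apply_mul_G_Qperp_mul hω f C D
  | algebraMap r =>
    refine ⟨algebraMap ℂ _ r, algebraMap ℂ _ r, rfl, rfl, fun C D => ?_⟩
    rw [sub_self, mul_zero, zero_mul, map_zero]
  | add x y _ _ hx hy =>
    obtain ⟨A, B, hA, hB, h⟩ := hx
    obtain ⟨A', B', hA', hB', h'⟩ := hy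
    refine ⟨A + A', B + B', ?_, ?_, fun C D => ?_⟩
    · rw [Subalgebra.coe_add, hA, hA', Prod.fst_add]
    · rw [Subalgebra.coe_add, hB, hB', Prod.snd_add]
    · rw [add_sub_add_comm, mul_add, add_mul, map_add, h, h', add_zero]
  | mul x y _ _ hx hy =>
    obtain ⟨A, B, hA, hB, h⟩ := hx
    obtain ⟨A', B', hA', hB', h'⟩ := hy
    refine ⟨A * A', B * B', ?_, ?_, fun C D => ?_⟩
    · rw [Subalgebra.coe_mul, hA, hA', Prod.fst_mul]
    · rw [Subalgebra.coe_mul, hB, hB', Prod.snd_mul]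
    · have e : C * (A * A' - B * B') * D = C * A * (A' - B') * D + C * (A - B) * (B' * D) := by
        noncomm_ring
      rw [e, map_add, h, h', add_zero]

/-- A positive functional takes the same values on both components of the graph of `body`. -/
theorem apply_eq_of_mem_graph (hω : IsPositiveFunctional ω) {A B : T.GAR}
    (h : ((A : T.Env), (B : T.Env)) ∈ T.graph) : ω A = ω B := by
  set K : ℝ := 4 * (ω 1).re
  have hK : ∀ X, ‖ω X‖ ≤ K * ‖X‖ := hω.norm_apply_le T.norm_star_le
  have hK0 : 0 ≤ K := by
    have h1 : 0 ≤ (ω 1).re := by simpa using (hω 1).1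
    positivity
  rw [← sub_eq_zero, ← norm_le_zero_iff]
  refine le_of_forall_pos_le_add fun δ hδ => ?_
  -- The approximation errors in the two components contribute at most 2Kη in total; the added 1
  -- keeps the denominator positive when K = 0.
  set η : ℝ := δ / (2 * K + 1)
  have hη : 0 < η := by positivity
  obtain ⟨⟨a, b⟩, hab, hd⟩ := Metric.mem_closure_iff.1 h η hη
  have hg : (a, b) ∈ T.graph := subset_closure hab
  have ha := T.fst_mem_of_mem_graph hg
  have hb := T.fermionic_le (T.snd_mem_of_mem_graph hg)
  have hz := apply_mul_sub_mul ha hb hω hab 1 1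
  rw [one_mul, mul_one, map_sub, sub_eq_zero] at hz
  rw [Prod.dist_eq, max_lt_iff] at hd
  have hA : ‖ω (A - ⟨a, ha⟩)‖ ≤ K * η := (hK _).trans (by
    gcongr
    have := hd.1.le
    rwa [dist_eq_norm] at this)
  have hB : ‖ω (B - ⟨b, hb⟩)‖ ≤ K * η := (hK _).trans (by
    gcongr
    have := hd.2.le
    rwa [dist_eq_norm] at this)
  have e : ω A - ω B = ω (A - ⟨a, ha⟩) - ω (B - ⟨b, hb⟩) := by
    rw [map_sub, map_sub, hz]
    ring
  have hle : ‖ω A - ω B‖ ≤ 2 * K * η := by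
    rw [e]
    exact (norm_sub_le _ _).trans (by linarith)
  have hmul : (2 * K + 1) * η = δ := by
    simp only [η]
    field_simp
  linarith

theorem apply_eq_incl_body (hω : IsPositiveFunctional ω) (A : T.GAR) :
    ω A = ω (T.incl (T.body A)) := by
  refine apply_eq_of_mem_graph hω ?_
  rw [coe_incl]
  exact T.mk_bodyFun_mem_graph A

theorem isPositiveFunctional_comp_incl (hω : IsPositiveFunctional ω) :
    IsPositiveFunctional (ω ∘ₗ T.inclLinearMap) := by
  intro A
  rw [LinearMap.comp_apply, inclLinearMap_apply, incl_mul, incl_star]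
  exact hω (T.incl A)

end GARData

end GrassmannCAR

end

theorem mainTheorem7 {H : Type*} [NormedAddCommGroup H] [InnerProductSpace ℂ H]
    [CompleteSpace H] [TopologicalSpace.SeparableSpace H] (T : GrassmannCAR.GARData H) :
    ∃ ε : T.GAR →⋆ₐ[ℂ] T.fermionicPart,
      Function.Surjective ε ∧
      (∀ Z ∈ T.nilpotentIdeal, ε Z = 0) ∧
      (∀ A : T.fermionicPart, ε (T.incl A) = A) ∧
      ∀ ω : T.GAR →ₗ[ℂ] ℂ, GrassmannCAR.IsPositiveFunctional ω →
        ∃! ω' : T.fermionicPart →ₗ[ℂ] ℂ,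
          GrassmannCAR.IsPositiveFunctional ω' ∧ ∀ A : T.GAR, ω A = ω' (ε A) := by
  refine ⟨T.body, fun A => ⟨T.incl A, T.body_incl A⟩,
    fun Z hZ => T.body_eq_zero_of_mem_nilpotentIdeal hZ, T.body_incl, fun ω hω => ?_⟩
  refine ⟨ω ∘ₗ T.inclLinearMap, ⟨GrassmannCAR.GARData.isPositiveFunctional_comp_incl hω,
    fun A => GrassmannCAR.GARData.apply_eq_incl_body hω A⟩, fun ω' hω' => ?_⟩
  -- Uniqueness: the homomorphism restricts to the identity on the fermionic part, so any
  -- factorization recovers ω' as the restriction of ω.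
  refine LinearMap.ext fun A => ?_
  rw [LinearMap.comp_apply, GrassmannCAR.GARData.inclLinearMap_apply, hω'.2, T.body_incl]
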